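/- Let $n\ge 2$ and write points of $\mathbb R^{n+1}$ as $(\mathbf x,y)\in\mathbb R^n\times\mathbb R$. For a hypersurface $\Gamma\subset\mathbb R^{n+1}$ with $n$-dimensional surface measure $\mu$ let $$\mathcal H(\Gamma)=(4\pi)^{-n/2}\int_\Gamma e^{-\|X\|^2/4}\,d\mu(X)$$ be its Huisken functional, and let $\Sigma=\{(\mathbf x,y):\|\mathbf x\|=\sqrt{2(n-1)}\}$ be the cylinder. There are constants $L_0>0$, $\delta_0>0$ and $C>0$, depending only on $n$, such that the following holds for all $L>L_0$ and $0<\delta<\delta_0$. Let $\Gamma=\{(\mathbf x,y):\|\mathbf x\|=u(y),\ |y|\le d\}$ with $d\ge 4L$ be a closed convex hypersurface of revolution which is symmetric under the reflection $y\mapsto -y$; that is, $u:[-d,d]\to[0,\infty)$ is continuous, concave and even, positive on $(-d,d)$, with $u(\pm d)=0$. Put $v(y)=u(y)-\sqrt{2(n-1)}$, and suppose that $\mathcal H(\Gamma)\le\mathcal H(\Sigma)$ and $$\sup_{|y|\le 4L}|v(y)|\le\delta .$$ Then $$\int_0^{2L}v_y^2\,e^{-y^2/4}\,dy\le C\int_0^L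 v^2\,e^{-y^2/4}\,dy \qquad\text{and}\qquad \int_L^{2L}v^2\,e^{-y^2/4}\,dy\le\frac{C}{L^2}\int_0^L v^2\,e^{-y^2/4}\,dy ,$$ where the first integral on the left is finite. -/

import Mathlib

open MeasureTheory Set

noncomputable section

/-- The ambient space `ℝⁿ × ℝ = ℝⁿ⁺¹` with coordinates `(𝐱, y)` and the Euclidean norm. -/
abbrev AmbientSpace (n : ℕ) : Type := WithLp 2 (EuclideanSpace ℝ (Fin n) × ℝ)

/-- The parametrization `(y, ω) ↦ (u(y) ω, y)`, `ω ∈ Sⁿ⁻¹`, of the hypersurface `‖𝐱‖ = u(y)`. -/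
def revolutionMap (n : ℕ) (u : ℝ → ℝ)
    (p : ℝ × Metric.sphere (0 : EuclideanSpace ℝ (Fin n)) 1) : AmbientSpace n :=
  WithLp.toLp 2 (u p.1 • (p.2 : EuclideanSpace ℝ (Fin n)), p.1)

/-- The `n`-dimensional surface measure of the hypersurface of revolution
`{(𝐱, y) : ‖𝐱‖ = u(y), y ∈ I}`, as a measure on the ambient space: the image under the
parametrization of its area element `u(y)ⁿ⁻¹ √(1 + u'(y)²) dy dσ(ω)`, where `σ` is the
standard surface measure of the unit sphere `Sⁿ⁻¹`. -/
def revolutionMeasure (n : ℕ) (I : Set ℝ) (u : ℝ → ℝ) : Measure (AmbientSpace n) :=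
  (((volume.restrict I).withDensity
      fun y => ENNReal.ofReal (u y ^ (n - 1) * √(1 + deriv u y ^ 2))).prod
    (volume : Measure (EuclideanSpace ℝ (Fin n))).toSphere).map (revolutionMap n u)

/-- Huisken's functional `(4π)^(-n/2) ∫ exp(-‖X‖²/4) dμ(X)` of a hypersurface with surface
measure `μ`, as a value in `[0, ∞]`. -/
def huisken (n : ℕ) (μ : Measure (AmbientSpace n)) : ENNReal :=
  ENNReal.ofReal ((4 * Real.pi) ^ (-(n : ℝ) / 2)) *
    ∫⁻ X, ENNReal.ofReal (Real.exp (-‖X‖ ^ 2 / 4)) ∂μ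

/-- The radius `√(2(n-1))` of the cylinder. -/
def cylinderRadius (n : ℕ) : ℝ := √(2 * ((n : ℝ) - 1))

/-- The surface measure of the cylinder `Σ = {(𝐱, y) : ‖𝐱‖ = √(2(n-1)), y ∈ ℝ}`. -/
def cylinderMeasure (n : ℕ) : Measure (AmbientSpace n) :=
  revolutionMeasure n univ fun _ => cylinderRadius n

/-- `u`, restricted to `[-d, d]`, is the profile of a closed convex hypersurface of revolution
`{(𝐱, y) : ‖𝐱‖ = u(y), |y| ≤ d}` with tips `(0, ±d)`, symmetric under `y ↦ -y`. No smoothness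
is imposed; being concave, `u` is differentiable at all but countably many points. -/
structure IsConvexProfile (d : ℝ) (u : ℝ → ℝ) : Prop where
  concave : ConcaveOn ℝ (Icc (-d) d) u
  continuous : ContinuousOn u (Icc (-d) d)
  pos : ∀ y ∈ Ioo (-d) d, 0 < u y
  tip : u d = 0
  even : ∀ y ∈ Icc (-d) d, u (-y) = u y

end

/-! Put m = n-1, F(r) = rᵐ exp(-r²/4), G the Gaussian tail and W = F(ρ), where ρ² = 2m makes ρ the
maximum point of F. Up to the area of the sphere, half of the functional of Γ is ∫ F(u) √(1+u'²)
exp(-y²/4) dy, while that of the cylinder is W G(0).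

Nothing is known about u far out, so the part beyond a = 2L is replaced by a boundary term: -(F(u)²
G / W)' is at most the area density (`calibration_pointwise`), and integrating up to the tip bounds
the outer area below by F(u(a))² G(a) / W. Since F ≥ W(1-v²), the comparison with the cylinder
cancels the zeroth order terms and leaves ∫ v'² ≲ ∫ v² + v(a)² G(a), with Gaussian weight on [0, a]
(`IsConvexProfile.energy_le`).

`gaussian_poincare` controls both a v(a)² exp(-a²/4) and ∫ y² v² by ∫ v² + ∫ v'². As G(a) ≤ (2/a)
exp(-a²/4), the boundary term carries a factor L⁻² and is absorbed. The y² moment then shows that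
the mass of v² on [L, 2L] is O(L⁻²) times the total, so that [0, L] dominates. -/

/-! ### The radial weight near its maximum -/

/-- The radial factor `rᵐ exp(-r²/4)` of the Gaussian area density. -/
noncomputable def radialWeight (m : ℕ) (r : ℝ) : ℝ := r ^ m * Real.exp (-r ^ 2 / 4)

/-- The derivative of `radialWeight m`. -/
noncomputable def radialWeightDeriv (m : ℕ) (r : ℝ) : ℝ :=
  (m * r ^ (m - 1) - r ^ (m + 1) / 2) * Real.exp (-r ^ 2 / 4)

lemma hasDerivAt_exp_neg_sq_div_four (r : ℝ) :
    HasDerivAt (fun s : ℝ => Real.exp (-s ^ 2 / 4)) (-(r / 2) * Real.exp (-r ^ 2 / 4)) r := by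
  have h : HasDerivAt (fun s : ℝ => -s ^ 2 / 4) (-(r / 2)) r := by
    have := ((hasDerivAt_pow 2 r).neg).div_const 4
    refine this.congr_deriv ?_
    simp only [Nat.cast_ofNat, Nat.add_one_sub_one, pow_one]; ring
  exact h.exp.congr_deriv (by ring)

lemma hasDerivAt_radialWeight (m : ℕ) (r : ℝ) :
    HasDerivAt (radialWeight m) (radialWeightDeriv m r) r := by
  refine ((hasDerivAt_pow m r).mul (hasDerivAt_exp_neg_sq_div_four r)).congr_deriv ?_
  unfold radialWeightDeriv; ring

lemma contDiff_radialWeight (m : ℕ) : ContDiff ℝ 1 (radialWeight m) := by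
  unfold radialWeight; fun_prop

lemma radialWeight_nonneg (m : ℕ) {r : ℝ} (hr : 0 ≤ r) : 0 ≤ radialWeight m r := by
  unfold radialWeight; positivity

lemma radialWeight_pos (m : ℕ) {r : ℝ} (hr : 0 < r) : 0 < radialWeight m r := by
  unfold radialWeight; positivity

/-- Rescaling by the maximum point reduces every exponent m to powers of the single function t
exp((1-t²)/2), whose maximum is 1 at t = 1. -/
lemma radialWeight_mul {m : ℕ} {ρ : ℝ} (hρ : ρ ^ 2 = 2 * m) (t : ℝ) :
    radialWeight m (ρ * t) = radialWeight m ρ * (t * Real.exp ((1 - t ^ 2) / 2)) ^ m := by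
  unfold radialWeight
  rw [mul_pow t, mul_pow ρ t m, ← Real.exp_nat_mul]
  have : Real.exp (-(ρ * t) ^ 2 / 4)
      = Real.exp (-ρ ^ 2 / 4) * Real.exp (m * ((1 - t ^ 2) / 2)) := by
    rw [← Real.exp_add, mul_pow, hρ]; congr 1; ring
  rw [this]; ring

/-- `rᵐ exp(-r²/4)` is, to second order, no smaller than its maximum. -/
lemma radialWeight_ge {m : ℕ} {ρ r : ℝ} (hρ0 : 0 < ρ) (hρ : ρ ^ 2 = 2 * m) (hr0 : 0 ≤ r)
    (hr : r ≤ 2 * ρ) :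
    radialWeight m ρ * (1 - (r - ρ) ^ 2) ≤ radialWeight m r := by
  obtain ⟨t, rfl⟩ : ∃ t, r = ρ * t := ⟨r / ρ, by field_simp⟩
  have ht0 : 0 ≤ t := nonneg_of_mul_nonneg_right hr0 hρ0
  have ht2 : t ≤ 2 := by nlinarith
  rw [radialWeight_mul hρ]
  refine mul_le_mul_of_nonneg_left ?_ (radialWeight_nonneg m hρ0.le)
  -- By exp x ≥ 1 + x the defect from 1 is at most (t-1)²(t+2)/2, and t ≤ 2. Bernoulli's inequality
  -- then passes to the m-th power, and 2m(t-1)² = (r-ρ)².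
  have hq : 1 - 2 * (t - 1) ^ 2 ≤ t * Real.exp ((1 - t ^ 2) / 2) := by
    have h1 := mul_le_mul_of_nonneg_left (Real.add_one_le_exp ((1 - t ^ 2) / 2)) ht0
    nlinarith [mul_nonneg (sq_nonneg (t - 1)) (sub_nonneg.2 ht2)]
  have hq0 : 0 ≤ t * Real.exp ((1 - t ^ 2) / 2) := by positivity
  have hb := one_add_mul_le_pow (a := t * Real.exp ((1 - t ^ 2) / 2) - 1) (by linarith) m
  rw [add_sub_cancel] at hb
  refine le_trans ?_ hb
  have : (ρ * t - ρ) ^ 2 = 2 * m * (t - 1) ^ 2 := by rw [← hρ]; ring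
  rw [this]
  have hm : (0 : ℝ) ≤ m := Nat.cast_nonneg m
  nlinarith [mul_le_mul_of_nonneg_left hq hm]

/-- With x = t² - 1 the left side is (1+x) exp(-x). Squaring exp(x/2) ≥ 1 + x/2 gives exp x ≥ 1 + x
+ x²/4, and x ≤ 3 bounds exp(-x) below. -/
lemma sq_mul_exp_le_one_sub {t : ℝ} (ht0 : 0 ≤ t) (ht2 : t ≤ 2) :
    (t * Real.exp ((1 - t ^ 2) / 2)) ^ 2 ≤ 1 - Real.exp (-3) / 4 * (1 - t ^ 2) ^ 2 := by
  set x := t ^ 2 - 1 with hx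
  have hx1 : -1 ≤ x := by nlinarith
  have hx3 : x ≤ 3 := by nlinarith
  have h0 : (t * Real.exp ((1 - t ^ 2) / 2)) ^ 2 = (1 + x) * Real.exp (-x) := by
    rw [mul_pow, ← Real.exp_nat_mul, hx]; push_cast; ring_nf
  have h1 : 1 + x + x ^ 2 / 4 ≤ Real.exp x := by
    have h : (x / 2 + 1) ^ 2 ≤ Real.exp (x / 2) ^ 2 :=
      pow_le_pow_left₀ (by linarith) (Real.add_one_le_exp (x / 2)) 2
    rw [← Real.exp_nat_mul] at h
    have e : ((2 : ℕ) : ℝ) * (x / 2) = x := by push_cast; ring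
    rw [e] at h; nlinarith
  have h2 := mul_le_mul_of_nonneg_right h1 (Real.exp_pos (-x)).le
  rw [← Real.exp_add, add_neg_cancel, Real.exp_zero] at h2
  have h3 : Real.exp (-3) ≤ Real.exp (-x) := Real.exp_le_exp.2 (by linarith)
  have h4 : (1 - t ^ 2) ^ 2 = x ^ 2 := by rw [hx]; ring
  rw [h0, h4]
  nlinarith [mul_le_mul_of_nonneg_left h3 (sq_nonneg x)]

/-- Near its maximum (and away from it) the squared slope of `rᵐ exp(-r²/4)` is controlled by the
gap of the squares to the maximal value. -/
lemma radialWeightDeriv_sq_le {m : ℕ} (hm : 1 ≤ m) {ρ r : ℝ} (hρ0 : 0 < ρ) (hρ : ρ ^ 2 = 2 * m)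
    (hr0 : 0 ≤ r) (hr : r ≤ 2 * ρ) :
    radialWeightDeriv m r ^ 2 ≤
      2 * m * Real.exp 4 * (radialWeight m ρ ^ 2 - radialWeight m r ^ 2) := by
  obtain ⟨t, rfl⟩ : ∃ t, r = ρ * t := ⟨r / ρ, by field_simp⟩
  have ht0 : 0 ≤ t := nonneg_of_mul_nonneg_right hr0 hρ0
  have ht2 : t ≤ 2 := by nlinarith
  obtain ⟨k, rfl⟩ : ∃ k, m = k + 1 := ⟨m - 1, by omega⟩
  set q := t * Real.exp ((1 - t ^ 2) / 2) with hq
  have hq0 : 0 ≤ q := by positivity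
  have hq2 := sq_mul_exp_le_one_sub ht0 ht2
  rw [← hq] at hq2
  have he3 := Real.exp_pos (-3)
  have hqle : q ^ 2 ≤ 1 := by nlinarith [mul_nonneg he3.le (sq_nonneg (1 - t ^ 2))]
  set W := radialWeight (k + 1) ρ with hW
  set M : ℝ := ((k + 1 : ℕ) : ℝ) with hM
  have hM0 : 0 < M := by positivity
  -- The derivative carries the factor 1 - t², whose square is exactly the gap supplied by
  -- `sq_mul_exp_le_one_sub`; the extra ρ is removed at the end through ρ² = 2m.
  have hD : ρ * radialWeightDeriv (k + 1) (ρ * t)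
      = W * q ^ k * (M * (1 - t ^ 2)) * Real.exp ((1 - t ^ 2) / 2) := by
    have hw : W * q ^ k * Real.exp ((1 - t ^ 2) / 2) = ρ * (radialWeight k (ρ * t)) := by
      have he : Real.exp (-(ρ * t) ^ 2 / 4)
          = Real.exp (-ρ ^ 2 / 4) * Real.exp (k * ((1 - t ^ 2) / 2))
            * Real.exp ((1 - t ^ 2) / 2) := by
        rw [← Real.exp_add, ← Real.exp_add, mul_pow, hρ, hM]; congr 1; push_cast; ring
      rw [hW, hq, radialWeight, radialWeight, mul_pow, ← Real.exp_nat_mul, he]; ring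
    have : W * q ^ k * (M * (1 - t ^ 2)) * Real.exp ((1 - t ^ 2) / 2)
        = (W * q ^ k * Real.exp ((1 - t ^ 2) / 2)) * (M * (1 - t ^ 2)) := by ring
    rw [this, hw]
    have h2 : M * (1 - t ^ 2) = M - (ρ * t) ^ 2 / 2 := by rw [mul_pow, hρ]; ring
    rw [h2, radialWeightDeriv, radialWeight, ← hM, Nat.add_sub_cancel]; ring
  have hqk : (q ^ k) ^ 2 ≤ 1 := by
    rw [← pow_mul, mul_comm, pow_mul]
    exact pow_le_one₀ (sq_nonneg q) hqle
  have hexp : Real.exp ((1 - t ^ 2) / 2) ^ 2 ≤ Real.exp 1 := by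
    rw [← Real.exp_nat_mul]; apply Real.exp_le_exp.2; push_cast; nlinarith
  have hqm : (q ^ (k + 1)) ^ 2 ≤ 1 - Real.exp (-3) / 4 * (1 - t ^ 2) ^ 2 := by
    refine le_trans ?_ hq2
    rw [← pow_mul, mul_comm, pow_mul]
    exact pow_le_of_le_one (sq_nonneg q) hqle (by omega)
  rw [radialWeight_mul hρ, ← hq, ← hW]
  have h5 : (ρ * radialWeightDeriv (k + 1) (ρ * t)) ^ 2
      ≤ W ^ 2 * (M * (1 - t ^ 2)) ^ 2 * Real.exp 1 := by
    rw [hD]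
    calc (W * q ^ k * (M * (1 - t ^ 2)) * Real.exp ((1 - t ^ 2) / 2)) ^ 2
        = (W ^ 2 * (M * (1 - t ^ 2)) ^ 2) *
            ((q ^ k) ^ 2 * Real.exp ((1 - t ^ 2) / 2) ^ 2) := by ring
      _ ≤ (W ^ 2 * (M * (1 - t ^ 2)) ^ 2) * (1 * Real.exp 1) := by gcongr
      _ = _ := by ring
  rw [mul_pow, hρ] at h5
  have h6 : Real.exp 4 * Real.exp (-3) = Real.exp 1 := by rw [← Real.exp_add]; norm_num
  have h7 : W ^ 2 * (Real.exp (-3) / 4 * (1 - t ^ 2) ^ 2)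
      ≤ W ^ 2 - (W * q ^ (k + 1)) ^ 2 := by
    rw [mul_pow]; nlinarith [mul_le_mul_of_nonneg_left hqm (sq_nonneg W)]
  have h8 := mul_le_mul_of_nonneg_left h7 (show 0 ≤ 2 * M * Real.exp 4 by positivity)
  refine le_trans ?_ h8
  have h9 : 2 * M * Real.exp 4 * (W ^ 2 * (Real.exp (-3) / 4 * (1 - t ^ 2) ^ 2))
      = W ^ 2 * M * (1 - t ^ 2) ^ 2 * Real.exp 1 / 2 := by rw [← h6]; ring
  rw [h9]
  refine le_of_mul_le_mul_left (h5.trans_eq ?_) (show 0 < 2 * M by positivity)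
  ring

/-! ### The Gaussian tail -/

/-- The Gaussian tail `∫_y^∞ exp(-s²/4) ds`. -/
noncomputable def gaussianTail (y : ℝ) : ℝ := ∫ s in Ioi y, Real.exp (-s ^ 2 / 4)

lemma integrable_exp_neg_sq_div_four : Integrable fun s : ℝ => Real.exp (-s ^ 2 / 4) := by
  convert integrable_exp_neg_mul_sq (b := 1 / 4) (by norm_num) using 3; ring

lemma gaussianTail_add (a b : ℝ) :
    (∫ s in a..b, Real.exp (-s ^ 2 / 4)) + gaussianTail b = gaussianTail a :=
  intervalIntegral.integral_interval_add_Ioi integrable_exp_neg_sq_div_four.integrableOn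
    integrable_exp_neg_sq_div_four.integrableOn

lemma hasDerivAt_gaussianTail (y : ℝ) :
    HasDerivAt gaussianTail (-Real.exp (-y ^ 2 / 4)) y := by
  have hc : Continuous fun s : ℝ => Real.exp (-s ^ 2 / 4) := by fun_prop
  have h : gaussianTail = fun y => gaussianTail 0 - ∫ s in (0 : ℝ)..y, Real.exp (-s ^ 2 / 4) := by
    funext y; rw [← gaussianTail_add 0 y]; ring
  rw [h]
  exact ((intervalIntegral.integral_hasDerivAt_right (hc.intervalIntegrable _ _)
    (hc.stronglyMeasurableAtFilter _ _) hc.continuousAt).const_sub _)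

lemma contDiff_gaussianTail : ContDiff ℝ 1 gaussianTail := by
  rw [contDiff_one_iff_deriv]
  refine ⟨fun y => (hasDerivAt_gaussianTail y).differentiableAt, ?_⟩
  have : deriv gaussianTail = fun y => -Real.exp (-y ^ 2 / 4) :=
    funext fun y => (hasDerivAt_gaussianTail y).deriv
  rw [this]; fun_prop

lemma gaussianTail_nonneg (y : ℝ) : 0 ≤ gaussianTail y :=
  integral_nonneg fun _ => (Real.exp_pos _).le

lemma gaussianTail_le {y : ℝ} (hy : 0 < y) :
    gaussianTail y ≤ 2 / y * Real.exp (-y ^ 2 / 4) := by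
  have hint : IntegrableOn (fun s : ℝ => s / y * Real.exp (-s ^ 2 / 4)) (Ioi y) := by
    have := (integrable_mul_exp_neg_mul_sq (b := 1 / 4) (by norm_num)).div_const y
    refine (this.congr (.of_forall fun s => ?_)).integrableOn
    simp only
    rw [show -(1 / 4 : ℝ) * s ^ 2 = -s ^ 2 / 4 by ring]; ring
  have hval : ∫ s in Ioi y, s / y * Real.exp (-s ^ 2 / 4) = 2 / y * Real.exp (-y ^ 2 / 4) := by
    have hd : ∀ x ∈ Ici y, HasDerivAt (fun s : ℝ => -(2 / y) * Real.exp (-s ^ 2 / 4))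
        (x / y * Real.exp (-x ^ 2 / 4)) x := fun x _ =>
      ((hasDerivAt_exp_neg_sq_div_four x).const_mul (-(2 / y))).congr_deriv (by ring)
    have ht : Filter.Tendsto (fun s : ℝ => -(2 / y) * Real.exp (-s ^ 2 / 4)) Filter.atTop
        (nhds 0) := by
      have h1 : Filter.Tendsto (fun s : ℝ => -s ^ 2 / 4) Filter.atTop Filter.atBot := by
        have := (Filter.tendsto_pow_atTop (α := ℝ) (n := 2) (by norm_num)).const_mul_atTop_of_neg
          (r := -1 / 4) (by norm_num)
        refine this.congr fun s => by ring
      simpa using (Real.tendsto_exp_atBot.comp h1).const_mul (-(2 / y))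
    rw [integral_Ioi_of_hasDerivAt_of_tendsto' hd hint ht]; ring
  rw [← hval]
  refine setIntegral_mono_on integrable_exp_neg_sq_div_four.integrableOn hint measurableSet_Ioi ?_
  intro s hs
  have : 1 ≤ s / y := (one_le_div hy).2 (le_of_lt hs)
  exact le_mul_of_one_le_left (Real.exp_pos _).le this

lemma integral_exp_neg_sq_div_four : ∫ s : ℝ, Real.exp (-s ^ 2 / 4) = 2 * gaussianTail 0 := by
  have := integral_comp_abs (f := fun s => Real.exp (-s ^ 2 / 4))
  simp only [sq_abs] at this
  exact this

/-! ### Calculus for Lipschitz profiles and the Poincaré inequality -/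

lemma intervalIntegrable_comp_deriv {u φ : ℝ → ℝ} {a b : ℝ} {K : NNReal} (hab : a ≤ b)
    (hu : LipschitzOnWith K u (Icc a b)) (hφ : Continuous φ) :
    IntervalIntegrable (fun y => φ (deriv u y)) volume a b := by
  obtain ⟨M, hM⟩ := (isCompact_Icc (a := -(K : ℝ)) (b := K)).exists_bound_of_continuousOn
    hφ.continuousOn
  -- The Lipschitz bound on [a, b] controls the two-sided derivative only at interior points.
  rw [intervalIntegrable_iff_integrableOn_Ioo_of_le hab]
  refine Measure.integrableOn_of_bounded (M := M) (by simp)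
    (hφ.measurable.comp (measurable_deriv u)).aestronglyMeasurable ?_
  refine (ae_restrict_mem measurableSet_Ioo).mono fun y hy => hM _ ?_
  have := norm_deriv_le_of_lipschitzOn (Icc_mem_nhds hy.1 hy.2) hu
  exact abs_le.1 this

lemma LipschitzOnWith.ae_restrict_differentiableAt {u : ℝ → ℝ} {a b : ℝ} {K : NNReal} (hab : a ≤ b)
    (hu : LipschitzOnWith K u (Icc a b)) :
    ∀ᵐ y ∂volume.restrict (Icc a b), DifferentiableAt ℝ u y := by
  rw [ae_restrict_iff' measurableSet_Icc]
  have := (LipschitzOnWith.absolutelyContinuousOnInterval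
    (by rwa [uIcc_of_le hab])).ae_differentiableAt (f := u) (a := a) (b := b)
  rwa [uIcc_of_le hab] at this

lemma ContDiff.absolutelyContinuousOnInterval_comp {h u : ℝ → ℝ} {a b : ℝ} {K : NNReal}
    (hab : a ≤ b) (hh : ContDiff ℝ 1 h) (hu : LipschitzOnWith K u (Icc a b)) :
    AbsolutelyContinuousOnInterval (fun y => h (u y)) a b := by
  obtain ⟨K', hK'⟩ := LocallyLipschitzOn.exists_lipschitzOnWith_of_compact
    (isCompact_Icc.image_of_continuousOn hu.continuousOn)
    (hh.locallyLipschitz.locallyLipschitzOn (s := u '' Icc a b))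
  have := hK'.comp hu (mapsTo_image u _)
  rw [← uIcc_of_le hab] at this
  exact this.absolutelyContinuousOnInterval

lemma ContDiff.absolutelyContinuousOnInterval {h : ℝ → ℝ} {a b : ℝ} (hab : a ≤ b)
    (hh : ContDiff ℝ 1 h) : AbsolutelyContinuousOnInterval h a b :=
  hh.absolutelyContinuousOnInterval_comp hab (LipschitzWith.id.lipschitzOnWith (s := Icc a b))

/-- A weighted Poincaré inequality with boundary term for the Gaussian weight. -/
lemma gaussian_poincare {v : ℝ → ℝ} {a : ℝ} {K : NNReal} (ha : 0 ≤ a)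
    (hv : LipschitzOnWith K v (Icc 0 a)) :
    a * v a ^ 2 * Real.exp (-a ^ 2 / 4)
        + 1 / 4 * ∫ y in (0 : ℝ)..a, y ^ 2 * (v y ^ 2 * Real.exp (-y ^ 2 / 4)) ≤
      (∫ y in (0 : ℝ)..a, v y ^ 2 * Real.exp (-y ^ 2 / 4))
        + 4 * ∫ y in (0 : ℝ)..a, deriv v y ^ 2 * Real.exp (-y ^ 2 / 4) := by
  have hexp : ContDiff ℝ 1 fun y : ℝ => y * Real.exp (-y ^ 2 / 4) := by fun_prop
  have hAC := (hexp.absolutelyContinuousOnInterval ha).fun_mul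
    (ContDiff.absolutelyContinuousOnInterval_comp (h := fun r => r ^ 2) ha (by fun_prop) hv)
  have hvc : ContinuousOn v (uIcc 0 a) := by rw [uIcc_of_le ha]; exact hv.continuousOn
  have i1 : IntervalIntegrable (fun y => v y ^ 2 * Real.exp (-y ^ 2 / 4)) volume 0 a :=
    ContinuousOn.intervalIntegrable ((hvc.pow 2).mul (by fun_prop))
  have i2 : IntervalIntegrable (fun y => y ^ 2 * (v y ^ 2 * Real.exp (-y ^ 2 / 4))) volume 0 a :=
    ContinuousOn.intervalIntegrable ((by fun_prop : ContinuousOn (fun y : ℝ => y ^ 2) _).mul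
      ((hvc.pow 2).mul (by fun_prop)))
  have i3 : IntervalIntegrable (fun y => deriv v y ^ 2 * Real.exp (-y ^ 2 / 4)) volume 0 a :=
    (intervalIntegrable_comp_deriv (φ := fun p => p ^ 2) ha hv (by fun_prop)).mul_continuousOn
      (by fun_prop)
  have hle : (∫ y in (0 : ℝ)..a, deriv (fun y => y * Real.exp (-y ^ 2 / 4) * v y ^ 2) y) ≤
      ∫ y in (0 : ℝ)..a, (v y ^ 2 * Real.exp (-y ^ 2 / 4)
        + 4 * (deriv v y ^ 2 * Real.exp (-y ^ 2 / 4))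
        - 1 / 4 * (y ^ 2 * (v y ^ 2 * Real.exp (-y ^ 2 / 4)))) := by
    refine intervalIntegral.integral_mono_ae_restrict ha hAC.intervalIntegrable_deriv
      ((i1.add (i3.const_mul 4)).sub (i2.const_mul _)) ?_
    filter_upwards [hv.ae_restrict_differentiableAt ha] with y hy
    have hd := (((hasDerivAt_id y).mul (hasDerivAt_exp_neg_sq_div_four y)).mul
      (hy.hasDerivAt.pow 2)).deriv
    have : deriv (fun y => y * Real.exp (-y ^ 2 / 4) * v y ^ 2) y = _ := hd
    rw [this]
    simp only [id, Pi.mul_apply, Pi.pow_apply, Nat.cast_ofNat, Nat.add_one_sub_one, pow_one]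
    have he := Real.exp_pos (-y ^ 2 / 4)
    -- The derivative is (v² - y²v²/2 + 2yvv') exp(-y²/4), and 2yvv' ≤ y²v²/4 + 4v'².
    nlinarith [mul_nonneg he.le (sq_nonneg (y * v y / 2 - 2 * deriv v y))]
  rw [hAC.integral_deriv_eq_sub, intervalIntegral.integral_sub (i1.add (i3.const_mul 4))
    (i2.const_mul _), intervalIntegral.integral_add i1 (i3.const_mul 4),
    intervalIntegral.integral_const_mul, intervalIntegral.integral_const_mul] at hle
  simp only [zero_mul, sub_zero] at hle
  have e : a * v a ^ 2 * Real.exp (-a ^ 2 / 4) = a * Real.exp (-a ^ 2 / 4) * v a ^ 2 := by ring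
  rw [e]; linarith

/-! ### The calibration -/

/-- The Gaussian area density of the hypersurface of revolution with profile `u`, up to the area
of the unit sphere. -/
noncomputable def gaussianDensity (m : ℕ) (u : ℝ → ℝ) (y : ℝ) : ℝ :=
  radialWeight m (u y) * √(1 + deriv u y ^ 2) * Real.exp (-y ^ 2 / 4)

lemma intervalIntegrable_gaussianDensity {m : ℕ} {u : ℝ → ℝ} {a b : ℝ} {K : NNReal} (hab : a ≤ b)
    (hu : LipschitzOnWith K u (Icc a b)) :
    IntervalIntegrable (gaussianDensity m u) volume a b := by
  have hc : ContinuousOn (fun y => radialWeight m (u y)) (uIcc a b) := by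
    rw [uIcc_of_le hab]
    exact (contDiff_radialWeight m).continuous.comp_continuousOn hu.continuousOn
  exact ((intervalIntegrable_comp_deriv (φ := fun p => √(1 + p ^ 2)) hab hu
    (by fun_prop)).continuousOn_mul hc).mul_continuousOn (by fun_prop)

/-- The pointwise calibration inequality. -/
lemma calibration_pointwise {m : ℕ} (hm : 1 ≤ m) {ρ r a y p : ℝ} (hρ0 : 0 < ρ)
    (hρ : ρ ^ 2 = 2 * m) (hr0 : 0 ≤ r) (hr : r ≤ 2 * ρ) (ha : 0 < a)
    (ham : 32 * m * Real.exp 4 ≤ a ^ 2) (hy : a ≤ y) :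
    radialWeight m r ^ 2 / radialWeight m ρ * Real.exp (-y ^ 2 / 4)
        - 2 * radialWeight m r * radialWeightDeriv m r / radialWeight m ρ * p * gaussianTail y ≤
      radialWeight m r * √(1 + p ^ 2) * Real.exp (-y ^ 2 / 4) := by
  have hD := radialWeightDeriv_sq_le hm hρ0 hρ hr0 hr
  have hW := radialWeight_pos m hρ0
  have hF := radialWeight_nonneg m hr0
  set W := radialWeight m ρ
  set F := radialWeight m r
  set D := radialWeightDeriv m r
  set E := Real.exp (-y ^ 2 / 4)
  have hE : 0 < E := Real.exp_pos _
  have hg0 := gaussianTail_nonneg y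
  have hy0 : 0 < y := ha.trans_le hy
  have hg : gaussianTail y ≤ 2 / a * E :=
    (gaussianTail_le hy0).trans (by gcongr)
  obtain ⟨θ, hθ⟩ : ∃ θ, gaussianTail y = θ * E := ⟨gaussianTail y / E, by field_simp⟩
  rw [hθ] at hg hg0 ⊢
  have hθ0 : 0 ≤ θ := nonneg_of_mul_nonneg_left hg0 hE
  have hθa : θ * a ≤ 2 := by
    have := le_of_mul_le_mul_right hg hE
    rwa [le_div_iff₀ ha] at this
  have hθ2 : θ ^ 2 * a ^ 2 ≤ 4 := by
    rw [← mul_pow]; nlinarith [mul_nonneg hθ0 ha.le]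
  -- The flux uses F²/W rather than F: its slack below F is what pays for the slope term, because D²
  -- is bounded by a multiple of W² - F². With θ ≤ 2/a this requires a² ≥ 32 m e⁴.
  have hsq : F ^ 2 + (2 * D * θ) ^ 2 ≤ W ^ 2 := by
    have h0 : 0 ≤ W ^ 2 - F ^ 2 := by
      by_contra hneg
      have : 0 < 2 * (m : ℝ) * Real.exp 4 := by positivity
      nlinarith [sq_nonneg D]
    have h1 : a ^ 2 * (2 * D * θ) ^ 2 ≤ a ^ 2 * (W ^ 2 - F ^ 2) := by
      calc a ^ 2 * (2 * D * θ) ^ 2 = 4 * D ^ 2 * (θ ^ 2 * a ^ 2) := by ring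
        _ ≤ 4 * D ^ 2 * 4 := by gcongr
        _ ≤ 16 * (2 * m * Real.exp 4 * (W ^ 2 - F ^ 2)) := by linarith
        _ = 32 * m * Real.exp 4 * (W ^ 2 - F ^ 2) := by ring
        _ ≤ a ^ 2 * (W ^ 2 - F ^ 2) := by gcongr
    have := le_of_mul_le_mul_left h1 (by positivity)
    linarith
  -- Cauchy–Schwarz for (F, -2Dθ) and (1, p).
  have hcs : F - 2 * D * θ * p ≤ W * √(1 + p ^ 2) := by
    refine abs_le_of_sq_le_sq' ?_ (by positivity) |>.2
    rw [mul_pow, Real.sq_sqrt (by positivity)]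
    nlinarith [sq_nonneg (F * p + 2 * D * θ),
      mul_le_mul_of_nonneg_right hsq (by positivity : 0 ≤ 1 + p ^ 2)]
  have h2 : F ^ 2 / W * E - 2 * F * D / W * p * (θ * E) = F * E / W * (F - 2 * D * θ * p) := by
    field_simp
  have h3 : F * √(1 + p ^ 2) * E = F * E / W * (W * √(1 + p ^ 2)) := by field_simp
  rw [h2, h3]
  exact mul_le_mul_of_nonneg_left hcs (by positivity)

/-- Far out, the Gaussian area of a hypersurface of revolution is bounded below by a calibration. -/
lemma calibration_le_integral {m : ℕ} (hm : 1 ≤ m) {ρ a b : ℝ} {u : ℝ → ℝ} {K : NNReal}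
    (hρ0 : 0 < ρ) (hρ : ρ ^ 2 = 2 * m) (ha : 0 < a) (ham : 32 * m * Real.exp 4 ≤ a ^ 2)
    (hab : a ≤ b) (hu : LipschitzOnWith K u (Icc a b))
    (hu0 : ∀ y ∈ Icc a b, 0 ≤ u y) (hu2 : ∀ y ∈ Icc a b, u y ≤ 2 * ρ) :
    radialWeight m (u a) ^ 2 / radialWeight m ρ * gaussianTail a
        - radialWeight m (u b) ^ 2 / radialWeight m ρ * gaussianTail b ≤
      ∫ y in a..b, gaussianDensity m u y := by
  have hAC := (ContDiff.absolutelyContinuousOnInterval_comp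
    (h := fun r => radialWeight m r ^ 2 / radialWeight m ρ) hab
    (((contDiff_radialWeight m).pow 2).div_const _) hu).fun_mul
    (contDiff_gaussianTail.absolutelyContinuousOnInterval hab)
  have hle : (∫ y in a..b, -deriv
      (fun y => radialWeight m (u y) ^ 2 / radialWeight m ρ * gaussianTail y) y) ≤
      ∫ y in a..b, gaussianDensity m u y := by
    refine intervalIntegral.integral_mono_ae_restrict hab hAC.intervalIntegrable_deriv.neg
      (intervalIntegrable_gaussianDensity hab hu) ?_
    filter_upwards [hu.ae_restrict_differentiableAt hab, ae_restrict_mem measurableSet_Icc]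
      with y hy hyI
    have hd : deriv (fun y => radialWeight m (u y) ^ 2 / radialWeight m ρ * gaussianTail y) y = _ :=
      (((((hasDerivAt_radialWeight m (u y)).comp y hy.hasDerivAt).pow 2).div_const
      (radialWeight m ρ)).mul (hasDerivAt_gaussianTail y)).deriv
    rw [hd]
    refine le_trans (le_of_eq ?_) (calibration_pointwise hm (p := deriv u y) hρ0 hρ (hu0 y hyI)
      (hu2 y hyI) ha ham hyI.1)
    simp only [Function.comp, Pi.pow_apply, Nat.cast_ofNat, Nat.add_one_sub_one, pow_one]
    ring
  rw [intervalIntegral.integral_neg, hAC.integral_deriv_eq_sub] at hle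
  linarith

/-! ### The Huisken functional as a one-dimensional integral -/

lemma norm_revolutionMap_sq (n : ℕ) (u : ℝ → ℝ)
    (p : ℝ × Metric.sphere (0 : EuclideanSpace ℝ (Fin n)) 1) :
    ‖revolutionMap n u p‖ ^ 2 = u p.1 ^ 2 + p.1 ^ 2 := by
  rw [WithLp.prod_norm_sq_eq_of_L2]
  simp [revolutionMap, norm_smul]

/-- Since ‖X‖² = u(y)² + y² does not depend on ω, Tonelli splits off the area of the sphere. That
common factor cancels when two hypersurfaces of revolution are compared. -/
lemma huisken_revolutionMeasure (n : ℕ) {I : Set ℝ} {u : ℝ → ℝ}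
    (hu : AEMeasurable u (volume.restrict I)) :
    huisken n (revolutionMeasure n I u) =
      ENNReal.ofReal ((4 * Real.pi) ^ (-(n : ℝ) / 2)) *
        ((volume : Measure (EuclideanSpace ℝ (Fin n))).toSphere univ *
          ∫⁻ y in I, ENNReal.ofReal (gaussianDensity (n - 1) u y)) := by
  set f : ℝ → ENNReal := fun y => ENNReal.ofReal (u y ^ (n - 1) * √(1 + deriv u y ^ 2)) with hf
  set σ := (volume : Measure (EuclideanSpace ℝ (Fin n))).toSphere
  have hfm : AEMeasurable f (volume.restrict I) :=
    ((hu.pow_const _).mul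
      (((measurable_deriv u).pow_const 2).const_add 1).sqrt.aemeasurable).ennreal_ofReal
  have hu' : AEMeasurable u ((volume.restrict I).withDensity f) :=
    hu.mono_ac (withDensity_absolutelyContinuous _ _)
  have hmap : AEMeasurable (revolutionMap n u) (((volume.restrict I).withDensity f).prod σ) := by
    have h1 : AEMeasurable (fun p : ℝ × Metric.sphere (0 : EuclideanSpace ℝ (Fin n)) 1 =>
        u p.1 • (p.2 : EuclideanSpace ℝ (Fin n))) (((volume.restrict I).withDensity f).prod σ) :=
      hu'.comp_fst.smul (measurable_subtype_coe.comp measurable_snd).aemeasurable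
    exact (WithLp.measurable_toLp 2 _).comp_aemeasurable (h1.prodMk measurable_fst.aemeasurable)
  set k : ℝ → ENNReal := fun y => ENNReal.ofReal (Real.exp (-(u y ^ 2 + y ^ 2) / 4)) with hk
  have hkm : AEMeasurable k (volume.restrict I) :=
    ((((hu.pow_const 2).add (by fun_prop)).neg.div_const 4).exp).ennreal_ofReal
  have hkm' : AEMeasurable k ((volume.restrict I).withDensity f) :=
    hkm.mono_ac (withDensity_absolutelyContinuous _ _)
  have hprod : f * k = fun y => ENNReal.ofReal (gaussianDensity (n - 1) u y) := by
    funext y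
    rw [Pi.mul_apply, hf, hk]
    simp only
    rw [← ENNReal.ofReal_mul' (Real.exp_pos _).le, gaussianDensity, radialWeight]
    congr 1
    rw [show -(u y ^ 2 + y ^ 2) / 4 = -u y ^ 2 / 4 + -y ^ 2 / 4 by ring, Real.exp_add]
    ring
  have hE : Measurable fun X : AmbientSpace n => ENNReal.ofReal (Real.exp (-‖X‖ ^ 2 / 4)) := by
    fun_prop
  unfold huisken revolutionMeasure
  rw [lintegral_map' hE.aemeasurable hmap]
  simp_rw [norm_revolutionMap_sq]
  rw [lintegral_prod _ (hkm'.comp_fst (ν := σ))]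
  simp only [lintegral_const]
  rw [lintegral_mul_const'' _ hkm', lintegral_withDensity_eq_lintegral_mul₀ hfm hkm, hprod,
    mul_comm (∫⁻ y in I, _)]

lemma gaussianDensity_const (m : ℕ) (ρ y : ℝ) :
    gaussianDensity m (fun _ => ρ) y = radialWeight m ρ * Real.exp (-y ^ 2 / 4) := by
  simp [gaussianDensity]

lemma lintegral_gaussianDensity_const (m : ℕ) {ρ : ℝ} (hρ : 0 ≤ ρ) :
    ∫⁻ y : ℝ, ENNReal.ofReal (gaussianDensity m (fun _ => ρ) y) =
      ENNReal.ofReal (2 * (radialWeight m ρ * gaussianTail 0)) := by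
  simp_rw [gaussianDensity_const]
  rw [← ofReal_integral_eq_lintegral_ofReal (integrable_exp_neg_sq_div_four.const_mul _)
    (.of_forall fun y => mul_nonneg (radialWeight_nonneg m hρ) (Real.exp_pos _).le),
    integral_const_mul, integral_exp_neg_sq_div_four]
  congr 1; ring

/-! ### Convex profiles and the comparison with the cylinder -/

lemma IsConvexProfile.nonneg {d : ℝ} {u : ℝ → ℝ} (hu : IsConvexProfile d u) {y : ℝ}
    (hy : y ∈ Icc (-d) d) : 0 ≤ u y := by
  have hd : 0 ≤ d := by linarith [hy.1, hy.2]
  rcases eq_or_lt_of_le hy.2 with h | h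
  · rw [h, hu.tip]
  rcases eq_or_lt_of_le hy.1 with h' | h'
  · rw [← h', hu.even d ⟨by linarith, le_rfl⟩, hu.tip]
  exact (hu.pos y ⟨h', h⟩).le

lemma IsConvexProfile.le_zero {d : ℝ} {u : ℝ → ℝ} (hu : IsConvexProfile d u) {y : ℝ}
    (hy : y ∈ Icc (-d) d) : u y ≤ u 0 := by
  have hy' : -y ∈ Icc (-d) d := ⟨by linarith [hy.2], by linarith [hy.1]⟩
  have h := hu.concave.2 hy hy' (show (0 : ℝ) ≤ 1 / 2 by norm_num)
    (show (0 : ℝ) ≤ 1 / 2 by norm_num) (by norm_num)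
  simp only [smul_eq_mul, hu.even y hy] at h
  rw [show 1 / 2 * y + 1 / 2 * -y = 0 by ring] at h
  linarith

lemma IsConvexProfile.exists_lipschitzOnWith {d b : ℝ} {u : ℝ → ℝ} (hu : IsConvexProfile d u)
    (hb : b < d) : ∃ K, LipschitzOnWith K u (Icc (-b) b) := by
  have hsub : Metric.ball (0 : ℝ) d ⊆ Icc (-d) d := by
    rw [Real.ball_eq_Ioo, zero_sub, zero_add]; exact Ioo_subset_Icc_self
  obtain ⟨K, hK⟩ := (hu.concave.subset hsub (convex_ball 0 d)).exists_lipschitzOnWith_of_isBounded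
    (r' := (b + d) / 2) (by linarith)
    ((isCompact_Icc.image_of_continuousOn hu.continuous).isBounded.subset (image_mono hsub))
  refine ⟨K, hK.mono ?_⟩
  rw [Real.ball_eq_Ioo]
  exact fun y hy => ⟨by linarith [hy.1], by linarith [hy.2]⟩

lemma IsConvexProfile.gaussianDensity_neg {d : ℝ} {u : ℝ → ℝ} (hu : IsConvexProfile d u) (m : ℕ)
    {y : ℝ} (hy : y ∈ Ioo (-d) d) : gaussianDensity m u (-y) = gaussianDensity m u y := by
  have hev : (fun x => u (-x)) =ᶠ[nhds y] u :=
    Filter.eventually_of_mem (Icc_mem_nhds hy.1 hy.2) hu.even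
  have hd : deriv u (-y) = -deriv u y := by
    rw [← hev.deriv_eq, deriv_comp_neg, neg_neg]
  simp only [gaussianDensity, hd, neg_sq, hu.even y (Ioo_subset_Icc_self hy)]

lemma cylinderRadius_sq {n : ℕ} (hn : 2 ≤ n) : cylinderRadius n ^ 2 = 2 * ((n - 1 : ℕ) : ℝ) := by
  have : (2 : ℝ) ≤ n := by exact_mod_cast hn
  rw [cylinderRadius, Real.sq_sqrt (by linarith), Nat.cast_sub (by omega), Nat.cast_one]

lemma one_lt_cylinderRadius {n : ℕ} (hn : 2 ≤ n) : 1 < cylinderRadius n := by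
  have : (2 : ℝ) ≤ n := by exact_mod_cast hn
  exact Real.lt_sqrt_of_sq_lt (by linarith)

/-- If the Huisken functional does not exceed that of the cylinder, then neither does the Gaussian
area of any part of the upper half. -/
lemma IsConvexProfile.integral_gaussianDensity_le {n : ℕ} (hn : 2 ≤ n) {d b : ℝ} {u : ℝ → ℝ}
    (hu : IsConvexProfile d u) (hb0 : 0 ≤ b) (hb : b < d)
    (hH : huisken n (revolutionMeasure n (Icc (-d) d) u) ≤ huisken n (cylinderMeasure n)) :
    ∫ y in (0 : ℝ)..b, gaussianDensity (n - 1) u y ≤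
      radialWeight (n - 1) (cylinderRadius n) * gaussianTail 0 := by
  have hρ : 0 < cylinderRadius n := one_pos.trans (one_lt_cylinderRadius hn)
  rw [cylinderMeasure, huisken_revolutionMeasure n
    (hu.continuous.aemeasurable measurableSet_Icc), huisken_revolutionMeasure n
    aemeasurable_const, Measure.restrict_univ, lintegral_gaussianDensity_const _ hρ.le] at hH
  have hσ0 : (volume : Measure (EuclideanSpace ℝ (Fin n))).toSphere univ ≠ 0 := by
    rw [Measure.measure_univ_ne_zero, Ne, Measure.toSphere_eq_zero_iff_finrank,
      finrank_euclideanSpace_fin]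
    omega
  rw [ENNReal.mul_le_mul_iff_right (by positivity) ENNReal.ofReal_ne_top,
    ENNReal.mul_le_mul_iff_right hσ0 (measure_ne_top _ _)] at hH
  obtain ⟨K, hK⟩ := hu.exists_lipschitzOnWith hb
  have hint := intervalIntegrable_gaussianDensity (m := n - 1) (by linarith) hK
  have hnn : ∀ y ∈ Ioc (-b) b, 0 ≤ gaussianDensity (n - 1) u y := fun y hy =>
    mul_nonneg (mul_nonneg (radialWeight_nonneg _ (hu.nonneg
      ⟨by linarith [hy.1], by linarith [hy.2]⟩)) (Real.sqrt_nonneg _)) (Real.exp_pos _).le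
  have h1 : ENNReal.ofReal (∫ y in (-b)..b, gaussianDensity (n - 1) u y) ≤
      ENNReal.ofReal (2 * (radialWeight (n - 1) (cylinderRadius n) * gaussianTail 0)) := by
    refine le_trans ?_ hH
    rw [intervalIntegral.integral_of_le (by linarith), ofReal_integral_eq_lintegral_ofReal hint.1
      ((ae_restrict_mem measurableSet_Ioc).mono hnn)]
    exact lintegral_mono_set fun y hy => ⟨by linarith [hy.1], by linarith [hy.2]⟩
  have h2 := (ENNReal.ofReal_le_ofReal_iff (mul_nonneg zero_le_two
    (mul_nonneg (radialWeight_nonneg _ hρ.le) (gaussianTail_nonneg 0)))).1 h1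
  have h3 : ∫ y in (-b)..0, gaussianDensity (n - 1) u y
      = ∫ y in (0 : ℝ)..b, gaussianDensity (n - 1) u y := by
    have := intervalIntegral.integral_comp_neg (a := 0) (b := b) (gaussianDensity (n - 1) u)
    rw [neg_zero] at this
    rw [← this]
    refine intervalIntegral.integral_congr fun y hy => ?_
    rw [uIcc_of_le hb0] at hy
    exact hu.gaussianDensity_neg _ ⟨by linarith [hy.1], by linarith [hy.2]⟩
  rw [← intervalIntegral.integral_add_adjacent_intervals (b := 0)
    (hint.mono_set (by
      rw [uIcc_of_le (by linarith), uIcc_of_le (by linarith)]; exact Icc_subset_Icc_right hb0))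
    (hint.mono_set (by
      rw [uIcc_of_le hb0, uIcc_of_le (by linarith)]; exact Icc_subset_Icc_left (by linarith))),
    h3] at h2
  linarith

/-- The calibration bound, together with the bound on the Huisken functional: the part of the
hypersurface beyond `a` is absorbed into a boundary term. -/
lemma IsConvexProfile.integral_add_boundary_le {n : ℕ} (hn : 2 ≤ n) {d a : ℝ} {u : ℝ → ℝ}
    (hu : IsConvexProfile d u) (ha : 0 < a) (had : a < d)
    (ham : 32 * ((n - 1 : ℕ) : ℝ) * Real.exp 4 ≤ a ^ 2) (hu0 : u 0 ≤ 2 * cylinderRadius n)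
    (hH : huisken n (revolutionMeasure n (Icc (-d) d) u) ≤ huisken n (cylinderMeasure n)) :
    (∫ y in (0 : ℝ)..a, gaussianDensity (n - 1) u y)
        + radialWeight (n - 1) (u a) ^ 2 / radialWeight (n - 1) (cylinderRadius n)
          * gaussianTail a ≤
      radialWeight (n - 1) (cylinderRadius n) * gaussianTail 0 := by
  have hρ : 0 < cylinderRadius n := one_pos.trans (one_lt_cylinderRadius hn)
  set W := radialWeight (n - 1) (cylinderRadius n)
  -- The profile may become vertical at the tip, so it is Lipschitz only on [a, b] with b < d. The
  -- calibration is applied there and then b → d; the outer flux vanishes because u(d) = 0 and F(0)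
  -- = 0, as n - 1 ≥ 1.
  have hb : ∀ b ∈ Ioo a d, (∫ y in (0 : ℝ)..a, gaussianDensity (n - 1) u y)
      + radialWeight (n - 1) (u a) ^ 2 / W * gaussianTail a
      ≤ W * gaussianTail 0 + radialWeight (n - 1) (u b) ^ 2 / W * gaussianTail b := by
    intro b hb
    have hb0 : 0 ≤ b := by linarith [hb.1]
    have h1 := hu.integral_gaussianDensity_le hn hb0 hb.2 hH
    obtain ⟨K, hK⟩ := hu.exists_lipschitzOnWith hb.2
    have hmem : ∀ y ∈ Icc a b, y ∈ Icc (-d) d := fun y hy =>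
      ⟨by linarith [hy.1], by linarith [hy.2, hb.2]⟩
    have hK1 := hK.mono (Icc_subset_Icc_left (by linarith : -b ≤ a))
    have hK0 := hK.mono (Icc_subset_Icc (by linarith : -b ≤ 0) hb.1.le)
    have h2 := calibration_le_integral (m := n - 1) (by omega) hρ (cylinderRadius_sq hn) ha ham
      hb.1.le hK1 (fun y hy => hu.nonneg (hmem y hy))
      (fun y hy => (hu.le_zero (hmem y hy)).trans hu0)
    rw [← intervalIntegral.integral_add_adjacent_intervals
      (intervalIntegrable_gaussianDensity ha.le hK0)
      (intervalIntegrable_gaussianDensity hb.1.le hK1)] at h1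
    linarith
  have hlim : Filter.Tendsto
      (fun b => W * gaussianTail 0 + radialWeight (n - 1) (u b) ^ 2 / W * gaussianTail b)
      (nhdsWithin d (Ioo a d)) (nhds (W * gaussianTail 0)) := by
    have hcu : Filter.Tendsto u (nhdsWithin d (Ioo a d)) (nhds 0) := by
      rw [← hu.tip]
      refine (hu.continuous d ⟨by linarith, le_rfl⟩).mono_left (nhdsWithin_mono _ ?_)
      exact fun y hy => ⟨by linarith [hy.1], hy.2.le⟩
    have hcF := ((contDiff_radialWeight (n - 1)).continuous.tendsto 0).comp hcu
    have hcg := (contDiff_gaussianTail.continuous.tendsto d).mono_left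
      (nhdsWithin_le_nhds (s := Ioo a d))
    have h0 : radialWeight (n - 1) 0 = 0 := by
      rw [radialWeight, zero_pow (by omega), zero_mul]
    have := (((hcF.pow 2).div_const W).mul hcg).const_add (W * gaussianTail 0)
    simpa [h0, Function.comp_def] using this
  have : (nhdsWithin d (Ioo a d)).NeBot := right_nhdsWithin_Ioo_neBot had
  exact ge_of_tendsto hlim (eventually_nhdsWithin_of_forall hb)

/-! ### The energy estimate and the absorption argument -/

/-- For |p| ≤ 1 the root is at least 1 + p²/4, and 1 - x² ≥ 3/4; hence 3/16. -/
lemma one_sub_add_le_mul_sqrt {x p : ℝ} (hx : |x| ≤ 1 / 2) (hp : |p| ≤ 1) :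
    1 - x ^ 2 + 3 / 16 * p ^ 2 ≤ (1 - x ^ 2) * √(1 + p ^ 2) := by
  have hx2 : x ^ 2 ≤ 1 / 4 := by
    rw [← sq_abs]; nlinarith [abs_nonneg x]
  have hp2 : p ^ 2 ≤ 1 := by
    rw [← sq_abs]; nlinarith [abs_nonneg p]
  have hs : 1 + p ^ 2 / 4 ≤ √(1 + p ^ 2) := by
    apply Real.le_sqrt_of_sq_le
    nlinarith [sq_nonneg p, mul_le_mul_of_nonneg_left hp2 (sq_nonneg p)]
  nlinarith [mul_le_mul_of_nonneg_left hs (by linarith : 0 ≤ 1 - x ^ 2),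
    mul_le_mul_of_nonneg_right hx2 (sq_nonneg p)]

/-- The energy estimate: on `[0, a]` the Dirichlet energy of the deviation from the cylinder is
bounded by its `L²` norm and a boundary term. -/
lemma IsConvexProfile.energy_le {n : ℕ} (hn : 2 ≤ n) {d a : ℝ} {u : ℝ → ℝ} {K : NNReal}
    (hu : IsConvexProfile d u) (ha : 0 < a) (had : a < d)
    (ham : 32 * ((n - 1 : ℕ) : ℝ) * Real.exp 4 ≤ a ^ 2)
    (hH : huisken n (revolutionMeasure n (Icc (-d) d) u) ≤ huisken n (cylinderMeasure n))
    (hK : LipschitzOnWith K u (Icc 0 a))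
    (hv : ∀ y ∈ Icc 0 a, |u y - cylinderRadius n| ≤ 1 / 2)
    (hd : ∀ y ∈ Icc 0 a, |deriv u y| ≤ 1) :
    3 / 16 * ∫ y in (0 : ℝ)..a, deriv u y ^ 2 * Real.exp (-y ^ 2 / 4) ≤
      (∫ y in (0 : ℝ)..a, (u y - cylinderRadius n) ^ 2 * Real.exp (-y ^ 2 / 4))
        + 2 * (u a - cylinderRadius n) ^ 2 * gaussianTail a := by
  have hρ1 := one_lt_cylinderRadius hn
  have hρ2 := cylinderRadius_sq hn
  set ρ := cylinderRadius n with hρ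
  have hρ0 : 0 < ρ := one_pos.trans hρ1
  have hrange : ∀ y ∈ Icc 0 a, 0 ≤ u y ∧ u y ≤ 2 * ρ := fun y hy => by
    have := abs_le.1 (hv y hy); constructor <;> linarith
  have hmain := hu.integral_add_boundary_le hn ha had ham (hrange 0 ⟨le_rfl, ha.le⟩).2 hH
  rw [← hρ] at hmain
  have hW := radialWeight_pos (n - 1) hρ0
  have hF : ∀ y ∈ Icc 0 a, radialWeight (n - 1) ρ * (1 - (u y - ρ) ^ 2)
      ≤ radialWeight (n - 1) (u y) := fun y hy =>
    radialWeight_ge hρ0 hρ2 (hrange y hy).1 (hrange y hy).2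
  set W := radialWeight (n - 1) ρ
  have hc : ContinuousOn u (uIcc 0 a) := by rw [uIcc_of_le ha.le]; exact hK.continuousOn
  have i0 : IntervalIntegrable (fun y : ℝ => Real.exp (-y ^ 2 / 4)) volume 0 a :=
    (by fun_prop : Continuous fun y : ℝ => Real.exp (-y ^ 2 / 4)).intervalIntegrable _ _
  have i1 : IntervalIntegrable (fun y => (u y - ρ) ^ 2 * Real.exp (-y ^ 2 / 4)) volume 0 a :=
    ContinuousOn.intervalIntegrable (((hc.sub continuousOn_const).pow 2).mul (by fun_prop))
  have i2 : IntervalIntegrable (fun y => deriv u y ^ 2 * Real.exp (-y ^ 2 / 4)) volume 0 a :=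
    (intervalIntegrable_comp_deriv (φ := fun p => p ^ 2) ha.le hK (by fun_prop)).mul_continuousOn
      (by fun_prop)
  have hlow : (∫ y in (0 : ℝ)..a, W * (Real.exp (-y ^ 2 / 4)
        - (u y - ρ) ^ 2 * Real.exp (-y ^ 2 / 4)
        + 3 / 16 * (deriv u y ^ 2 * Real.exp (-y ^ 2 / 4)))) ≤
      ∫ y in (0 : ℝ)..a, gaussianDensity (n - 1) u y := by
    refine intervalIntegral.integral_mono_on ha.le
      (((i0.sub i1).add (i2.const_mul _)).const_mul W)
      (intervalIntegrable_gaussianDensity ha.le hK) fun y hy => ?_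
    have h1 := one_sub_add_le_mul_sqrt (hv y hy) (hd y hy)
    have hE := Real.exp_pos (-y ^ 2 / 4)
    calc W * (Real.exp (-y ^ 2 / 4) - (u y - ρ) ^ 2 * Real.exp (-y ^ 2 / 4)
          + 3 / 16 * (deriv u y ^ 2 * Real.exp (-y ^ 2 / 4)))
        = W * (1 - (u y - ρ) ^ 2 + 3 / 16 * deriv u y ^ 2) * Real.exp (-y ^ 2 / 4) := by ring
      _ ≤ W * ((1 - (u y - ρ) ^ 2) * √(1 + deriv u y ^ 2)) * Real.exp (-y ^ 2 / 4) := by gcongr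
      _ = W * (1 - (u y - ρ) ^ 2) * √(1 + deriv u y ^ 2) * Real.exp (-y ^ 2 / 4) := by ring
      _ ≤ gaussianDensity (n - 1) u y := by
        unfold gaussianDensity; gcongr; exact hF y hy
  rw [intervalIntegral.integral_const_mul, intervalIntegral.integral_add (i0.sub i1)
    (i2.const_mul _), intervalIntegral.integral_sub i0 i1,
    intervalIntegral.integral_const_mul] at hlow
  -- From F ≥ W(1-v²) and (1-v²)² ≥ 1 - 2v². The leading part W G(a) is the cylinder's own area
  -- beyond a, so it cancels.
  have hbdry : W * ((1 - 2 * (u a - ρ) ^ 2) * gaussianTail a) ≤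
      radialWeight (n - 1) (u a) ^ 2 / W * gaussianTail a := by
    rw [← mul_assoc]
    refine mul_le_mul_of_nonneg_right ?_ (gaussianTail_nonneg a)
    have haI : a ∈ Icc 0 a := ⟨ha.le, le_rfl⟩
    have h1 := hF a haI
    have h2 : 0 ≤ 1 - (u a - ρ) ^ 2 := by
      have := hv a haI
      rw [← sq_abs]; nlinarith [abs_nonneg (u a - ρ)]
    have h3 := pow_le_pow_left₀ (mul_nonneg hW.le h2) h1 2
    rw [le_div_iff₀ hW]
    nlinarith [mul_nonneg (sq_nonneg W) (sq_nonneg ((u a - ρ) ^ 2))]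
  rw [← gaussianTail_add 0 a] at hmain
  have hfin := (add_le_add hlow hbdry).trans hmain
  rw [← mul_add] at hfin
  have := le_of_mul_le_mul_left hfin hW
  linarith

/-- A concave function oscillating by at most 1 on [-4L, 4L] has slope at most 1/L at distance L
from the endpoints. -/
lemma IsConvexProfile.lipschitzOnWith_one {d L ρ : ℝ} {u : ℝ → ℝ} (hu : IsConvexProfile d u)
    (hL : 1 ≤ L) (hd : 4 * L ≤ d) (hv : ∀ y : ℝ, |y| ≤ 4 * L → |u y - ρ| ≤ 1 / 2) :
    LipschitzOnWith 1 u (Metric.ball 0 (3 * L)) := by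
  have hsub : Metric.ball (0 : ℝ) (4 * L) ⊆ Icc (-d) d := by
    rw [Real.ball_eq_Ioo]
    exact fun y hy => ⟨by linarith [hy.1], by linarith [hy.2]⟩
  have hc := (hu.concave.subset hsub (convex_ball 0 (4 * L))).add_const (-ρ)
  have h := hc.lipschitzOnWith_of_abs_le (ε := L) (M := 1 / 2) (by linarith) fun y hy => by
    rw [Real.dist_0_eq_abs] at hy
    simpa [sub_eq_add_neg] using hv y hy.le
  rw [show 4 * L - L = 3 * L by ring] at h
  refine LipschitzOnWith.of_dist_le_mul fun x hx y hy => ?_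
  have hxy := h.dist_le_mul x hx y hy
  simp only [dist_add_right, Pi.add_apply] at hxy
  refine hxy.trans (mul_le_mul_of_nonneg_right ?_ dist_nonneg)
  rw [NNReal.coe_le_coe, Real.toNNReal_le_one, div_le_one (by linarith)]
  linarith

theorem mainTheorem8 (n : ℕ) (hn : 2 ≤ n) :
    ∃ L₀ > (0 : ℝ), ∃ δ₀ > (0 : ℝ), ∃ C > (0 : ℝ),
      ∀ (L δ d : ℝ) (u : ℝ → ℝ), L₀ < L → 0 < δ → δ < δ₀ → 4 * L ≤ d →
        IsConvexProfile d u →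
        huisken n (revolutionMeasure n (Icc (-d) d) u) ≤ huisken n (cylinderMeasure n) →
        (∀ y : ℝ, |y| ≤ 4 * L → |u y - cylinderRadius n| ≤ δ) →
        ∀ v : ℝ → ℝ, v = (fun y => u y - cylinderRadius n) →
          IntervalIntegrable (fun y => deriv v y ^ 2 * Real.exp (-y ^ 2 / 4)) volume 0 (2 * L) ∧
          (∫ y in (0 : ℝ)..(2 * L), deriv v y ^ 2 * Real.exp (-y ^ 2 / 4)) ≤
            C * ∫ y in (0 : ℝ)..L, v y ^ 2 * Real.exp (-y ^ 2 / 4) ∧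
          (∫ y in L..(2 * L), v y ^ 2 * Real.exp (-y ^ 2 / 4)) ≤
            C / L ^ 2 * ∫ y in (0 : ℝ)..L, v y ^ 2 * Real.exp (-y ^ 2 / 4) := by
  -- The term 8 m e⁴ gives (2L)² ≥ 32 m e⁴, as the calibration from a = 2L requires; 20 gives L² ≥
  -- 400 for the absorption. The final bounds are D ≤ 18 J and L² T ≤ 296 J.
  refine ⟨20 + 8 * ((n - 1 : ℕ) : ℝ) * Real.exp 4, by positivity, 1 / 2, by norm_num, 300,
    by norm_num, ?_⟩
  intro L δ d u hL _ hδ hLd hu hH hsup v hvdef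
  have hmE : 0 ≤ 8 * ((n - 1 : ℕ) : ℝ) * Real.exp 4 := by positivity
  have hL20 : 20 ≤ L := by linarith
  have hL0 : 0 < L := by linarith
  have hsup' : ∀ y : ℝ, |y| ≤ 4 * L → |u y - cylinderRadius n| ≤ 1 / 2 := fun y hy =>
    (hsup y hy).trans hδ.le
  have hlip := hu.lipschitzOnWith_one (by linarith) hLd hsup'
  have hderiv : ∀ y ∈ Icc 0 (2 * L), |deriv u y| ≤ 1 := fun y hy => by
    have hmem : y ∈ Metric.ball (0 : ℝ) (3 * L) := by
      rw [Real.ball_eq_Ioo]; exact ⟨by linarith [hy.1], by linarith [hy.2]⟩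
    simpa using norm_deriv_le_of_lipschitzOn (Metric.isOpen_ball.mem_nhds hmem) hlip
  have hK : LipschitzOnWith 1 u (Icc 0 (2 * L)) := hlip.mono fun y hy => by
    rw [Real.ball_eq_Ioo]; exact ⟨by linarith [hy.1], by linarith [hy.2]⟩
  have hvI : ∀ y ∈ Icc 0 (2 * L), |u y - cylinderRadius n| ≤ 1 / 2 := fun y hy =>
    hsup' y (by rw [abs_of_nonneg hy.1]; linarith [hy.2])
  have henergy := hu.energy_le hn (a := 2 * L) (by linarith) (by linarith) (by nlinarith) hH hK
    hvI hderiv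
  have hdv : deriv v = deriv u := by
    rw [hvdef]; funext y; exact deriv_sub_const _
  have hKv : LipschitzOnWith 1 v (Icc 0 (2 * L)) := by
    refine LipschitzOnWith.of_dist_le_mul fun x hx y hy => ?_
    simpa only [hvdef, dist_sub_right] using hK.dist_le_mul x hx y hy
  have hpoin := gaussian_poincare (by linarith : 0 ≤ 2 * L) hKv
  have hcv : ContinuousOn v (Icc 0 (2 * L)) := hKv.continuousOn
  have hI : ∀ a b : ℝ, 0 ≤ a → a ≤ b → b ≤ 2 * L →
      IntervalIntegrable (fun y => v y ^ 2 * Real.exp (-y ^ 2 / 4)) volume a b := by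
    intro a b ha hab hb
    refine ContinuousOn.intervalIntegrable (((hcv.mono ?_).pow 2).mul (by fun_prop))
    rw [uIcc_of_le hab]; exact Icc_subset_Icc ha hb
  have hY : ∀ a b : ℝ, 0 ≤ a → a ≤ b → b ≤ 2 * L →
      IntervalIntegrable (fun y => y ^ 2 * (v y ^ 2 * Real.exp (-y ^ 2 / 4))) volume a b :=
    fun a b ha hab hb => (hI a b ha hab hb).continuousOn_mul (by fun_prop)
  have hadj := intervalIntegral.integral_add_adjacent_intervals
    (hI 0 L le_rfl hL0.le (by linarith)) (hI L (2 * L) hL0.le (by linarith) le_rfl)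
  have hYsplit := intervalIntegral.integral_add_adjacent_intervals
    (hY 0 L le_rfl hL0.le (by linarith)) (hY L (2 * L) hL0.le (by linarith) le_rfl)
  have hY0 : 0 ≤ ∫ y in (0 : ℝ)..L, y ^ 2 * (v y ^ 2 * Real.exp (-y ^ 2 / 4)) :=
    intervalIntegral.integral_nonneg hL0.le fun y _ => by positivity
  have hYL : L ^ 2 * ∫ y in L..(2 * L), v y ^ 2 * Real.exp (-y ^ 2 / 4) ≤
      ∫ y in L..(2 * L), y ^ 2 * (v y ^ 2 * Real.exp (-y ^ 2 / 4)) := by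
    rw [← intervalIntegral.integral_const_mul]
    refine intervalIntegral.integral_mono_on (by linarith)
      ((hI L (2 * L) hL0.le (by linarith) le_rfl).const_mul _)
      (hY L (2 * L) hL0.le (by linarith) le_rfl) fun y hy => ?_
    exact mul_le_mul_of_nonneg_right (pow_le_pow_left₀ hL0.le hy.1 2) (by positivity)
  have hJ0 : 0 ≤ ∫ y in (0 : ℝ)..L, v y ^ 2 * Real.exp (-y ^ 2 / 4) :=
    intervalIntegral.integral_nonneg hL0.le fun y _ => by positivity
  have hT0 : 0 ≤ ∫ y in L..(2 * L), v y ^ 2 * Real.exp (-y ^ 2 / 4) :=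
    intervalIntegral.integral_nonneg (by linarith) fun y _ => by positivity
  have hD0 : 0 ≤ ∫ y in (0 : ℝ)..(2 * L), deriv v y ^ 2 * Real.exp (-y ^ 2 / 4) :=
    intervalIntegral.integral_nonneg (by linarith) fun y _ => by positivity
  have hvy : ∀ y, u y - cylinderRadius n = v y := fun y => by rw [hvdef]
  have htail := gaussianTail_le (by linarith : 0 < 2 * L)
  simp only [hvy, ← hdv] at henergy
  refine ⟨(intervalIntegrable_comp_deriv (φ := fun p => p ^ 2) (by linarith) hKv
    (by fun_prop)).mul_continuousOn (by fun_prop), ?_⟩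
  rw [← hadj] at henergy hpoin
  rw [← hYsplit] at hpoin
  set J := ∫ y in (0 : ℝ)..L, v y ^ 2 * Real.exp (-y ^ 2 / 4)
  set T := ∫ y in L..(2 * L), v y ^ 2 * Real.exp (-y ^ 2 / 4)
  set D := ∫ y in (0 : ℝ)..(2 * L), deriv v y ^ 2 * Real.exp (-y ^ 2 / 4)
  set E := Real.exp (-(2 * L) ^ 2 / 4)
  have hE : 0 < E := Real.exp_pos _
  have hb0 : 0 ≤ v (2 * L) ^ 2 * E := by positivity
  have hLsq : 400 ≤ L ^ 2 := by nlinarith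
  -- The tail bound turns the left side into at most 2L v(2L)² E, which is the boundary term of
  -- `gaussian_poincare` at a = 2L.
  have hbd : L ^ 2 * (2 * v (2 * L) ^ 2 * gaussianTail (2 * L)) ≤ J + T + 4 * D := by
    have h1 : 2 * v (2 * L) ^ 2 * gaussianTail (2 * L) ≤ 2 * v (2 * L) ^ 2 * (2 / (2 * L) * E) :=
      mul_le_mul_of_nonneg_left htail (by positivity)
    have h2 : L ^ 2 * (2 * v (2 * L) ^ 2 * (2 / (2 * L) * E)) = 2 * L * v (2 * L) ^ 2 * E := by
      field_simp
    have h3 := mul_le_mul_of_nonneg_left h1 (sq_nonneg L)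
    nlinarith [mul_nonneg (sq_nonneg L) hT0]
  have hTL : L ^ 2 * T ≤ 4 * (J + T + 4 * D) := by
    nlinarith [mul_nonneg hL0.le hb0]
  have hB : 400 * (2 * v (2 * L) ^ 2 * gaussianTail (2 * L)) ≤ J + T + 4 * D :=
    le_trans (mul_le_mul_of_nonneg_right hLsq
      (mul_nonneg (by positivity) (gaussianTail_nonneg _))) hbd
  -- The boundary term contributes at most D/100 on the right, which the coefficient 3/16 absorbs.
  have hDle : D ≤ 9 * (J + T) := by linarith
  have hT400 : 400 * T ≤ 148 * (J + T) := by
    have := mul_le_mul_of_nonneg_right hLsq hT0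
    linarith
  have hTJ : T ≤ J := by linarith
  refine ⟨by linarith, ?_⟩
  rw [div_mul_eq_mul_div, le_div_iff₀ (by positivity)]
  linarith
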